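/- Let $\epsilon\in(0,2)$ and $C>0$ be constants. There are a constant $c>0$ and integers $K,n_0\ge 0$, depending only on $\epsilon$ and $C$, such that the following holds for all $n\ge n_0$, all positive integers $\ell<\log^C n$ and all $s$. Consider any randomized single-pass streaming algorithm that keeps $s$ bits of memory and that, for every unweighted simple graph $G=(V,E)$ with $|V|=n$ and $E\neq\emptyset$, given one pass over a stream of $\ell\cdot n$ independent uniformly random samples of the edge set $E$, outputs with probability at least $99/100$ (over the samples and its internal randomness) a $(2-\epsilon)$-approximation to the value $\mathrm{OPT}(G)$ of the maximum cut of $G$, i.e. a number in the interval $[\mathrm{OPT}(G)/(2-\epsilon),\,\mathrm{OPT}(G)]$. Then $$ s\;\ge\; c\,\frac{\sqrt n}{\log^K n}. $$ In other words, every such algorithm must use $\tilde\Omega(\sqrt n)$ space. -/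

import Mathlib

noncomputable section

namespace MaxCutStream

/-- The maximum, over all bipartitions `(S, Sᶜ)` of the vertex set, of the number of edges of `G`
with one endpoint in `S` and the other one in `Sᶜ`. -/
def maxCut {V : Type*} [Fintype V] (G : SimpleGraph V) : ℕ :=
  open Classical in
  (Finset.univ : Finset (Finset V)).sup fun S => (G.interedges S Sᶜ).card

/-- The law of one uniformly random edge of a graph that has an edge. -/
def edgeSample {V : Type*} [Fintype V] (G : SimpleGraph V) (hG : G.edgeSet.Nonempty) :
    PMF (Sym2 V) :=
  open Classical in
  PMF.uniformOfFinset G.edgeFinset (by simpa [Finset.nonempty_iff_ne_empty] using hG.ne_empty)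

/-- The law of a sequence of `T` independent samples from `p`. -/
def iid {α : Type*} (p : PMF α) : ℕ → PMF (List α)
  | 0 => PMF.pure []
  | T + 1 => p.bind fun a => (iid p T).map fun σ => a :: σ

/-- A randomized single-pass streaming algorithm for graphs on the vertex set `Fin n` that uses
`s` bits of space. Its only memory between two stream elements is a string of `s` bits.
As is usual for lower bounds, the model is non-uniform and generous: the random tape (the seed),
the number of elements read so far and the computation inside a step are not charged. -/
structure StreamingAlgorithm (n s : ℕ) where
  /-- the possible contents of the random tape -/
  Seed : Type
  /-- the law of the random tape -/
  coins : PMF Seed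
  /-- the initial memory state -/
  init : Seed → (Fin s → Bool)
  /-- the memory state after reading an edge, given the number of edges read before it and the
  previous memory state -/
  update : Seed → ℕ → (Fin s → Bool) → Sym2 (Fin n) → (Fin s → Bool)
  /-- the value that is output at the end of the stream -/
  output : Seed → (Fin s → Bool) → ℝ

namespace StreamingAlgorithm

variable {n s : ℕ} (A : StreamingAlgorithm n s)

/-- The memory state after reading a stream, from the state `q` in which `t` edges were read. -/
def runFrom (r : A.Seed) : ℕ → (Fin s → Bool) → List (Sym2 (Fin n)) → (Fin s → Bool)
  | _, q, [] => q
  | t, q, e :: σ => runFrom r (t + 1) (A.update r t q e) σ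

/-- The output on the random tape `r` and the stream `σ`. -/
def eval (r : A.Seed) (σ : List (Sym2 (Fin n))) : ℝ :=
  A.output r (A.runFrom r 0 (A.init r) σ)

/-- The law of the output when the stream has law `stream` and is independent of the coins. -/
def outputLaw (stream : PMF (List (Sym2 (Fin n)))) : PMF ℝ :=
  A.coins.bind fun r => stream.map (A.eval r)

/-- For every graph `G` on `n` vertices with at least one edge, after one pass over `T` i.i.d.
uniform samples of the edges of `G`, the output is a `γ`-approximation to the maximum cut of `G`,
i.e. lies in `[OPT / γ, OPT]`, with probability at least `p` over the samples and the coins. -/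
def ApproximatesMaxCut (T : ℕ) (γ : ℝ) (p : ENNReal) : Prop :=
  ∀ (G : SimpleGraph (Fin n)) (hG : G.edgeSet.Nonempty),
    p ≤ (A.outputLaw (iid (edgeSample G hG) T)).toMeasure
      (Set.Icc ((maxCut G : ℝ) / γ) (maxCut G : ℝ))

end StreamingAlgorithm

end MaxCutStream

end

/-!
The lower bound compares three laws of the stream: `T` independent edges of the complete bipartite
graph between a random half of the vertices and its complement, `T` independent edges of a random
graph with half of all pairs as edges, and `T` independent uniformly random pairs. Graphs of the
first kind have a maximum cut of about `n² / 4`, those of the second kind of about `n² / 8`, so a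
`(2 - ε)`-approximation tells the first law from the second one. A memory of few bits, however,
cannot tell either of them from the third one.

To see the latter, let `x` be the hidden parameter of a random graph. By the chain rule and the data
processing inequality, the relative entropy between the laws of the memory state grows at each
step by at most the mean, over the current state `q`, of the relative entropy between the law of the
next edge given `q` and the uniform law. The latter is at most the `χ²`-divergence, which is the mean
over all pairs `e` of the square of the bias of the sign `z x e` telling whether `e` is an edge, under
the law of `x` given `q`. In both families these signs are, up to a factor `-1`, distinct characters,
of degree two and one, on a discrete cube of which the family is a fraction of at least `n⁻²`. The state `q` has `2 ^ s`
possible values, so hypercontractivity bounds the sum of the squared biases by `O((s + log n)²)` on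
average over `q`. Hence `T = ℓ * n` steps cost `O(ℓ * (s + log n)² / n)`, which has to be at least
a constant.

The hypercontractive inequality is `sum_walsh_pow_le`, the bound on the biases is `sum_bias_sq_le`,
and the chain rule is `sum_streamExpect_le_log`. The chain rule is stated in its dual form, for the
exponential functional of an arbitrary test function, so that no laws of states under the uniform
stream and no logarithms of their ratios appear. `two_pow_le_card_smallCutFamily` provides the graphs
with small cuts, and `le_mul_sq_of_approximatesMaxCut` is the resulting bound for fixed `n`.
-/

namespace MaxCutStream
open Finset

/-! ### Hypercontractivity on the discrete cube -/

/-- The `i`-th coordinate, a sign, of the point of the discrete cube given by the finset `x`: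
`-1` on `x` and `1` off `x`. -/
noncomputable def sgn {ι : Type*} [DecidableEq ι] (x : Finset ι) (i : ι) : ℝ :=
  if i ∈ x then -1 else 1

/-- The Walsh character `x ↦ (-1) ^ |S ∩ x|` on the discrete cube, whose points are encoded as
finsets. -/
noncomputable def walsh {ι : Type*} [DecidableEq ι] (S x : Finset ι) : ℝ :=
  ∏ i ∈ S, sgn x i

lemma choose_two_mul_le (k j : ℕ) : (2 * k).choose (2 * j) ≤ (2 * k) ^ j * k.choose j := by
  induction j with
  | zero => simp
  | succ j ih =>
    have h1 := Nat.choose_succ_right_eq (2 * k) (2 * j)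
    have h2 := Nat.choose_succ_right_eq (2 * k) (2 * j + 1)
    have h3 := Nat.choose_succ_right_eq k j
    have h4 : (2 * k).choose (2 * j + 2) * ((2 * j + 1) * (2 * (j + 1)))
        ≤ (2 * k) ^ (j + 1) * k.choose (j + 1) * (1 * (2 * (j + 1))) := by
      calc (2 * k).choose (2 * j + 2) * ((2 * j + 1) * (2 * (j + 1)))
          = (2 * k).choose (2 * j + 1 + 1) * (2 * j + 1 + 1) * (2 * j + 1) := by ring
        _ = (2 * k).choose (2 * j + 1) * (2 * j + 1) * (2 * k - (2 * j + 1)) := by rw [h2]; ring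
        _ = (2 * k).choose (2 * j) * ((2 * k - 2 * j) * (2 * k - (2 * j + 1))) := by rw [h1]; ring
        _ ≤ ((2 * k) ^ j * k.choose j) * ((2 * (k - j)) * (2 * k)) := by
            gcongr
            · omega
            · omega
        _ = (2 * k) ^ (j + 1) * (k.choose j * (k - j)) * 2 := by ring
        _ = (2 * k) ^ (j + 1) * (k.choose (j + 1) * (j + 1)) * 2 := by rw [h3]
        _ = _ := by ring
    have h5 : (2 * k) ^ (j + 1) * k.choose (j + 1) * (1 * (2 * (j + 1)))
        ≤ (2 * k) ^ (j + 1) * k.choose (j + 1) * ((2 * j + 1) * (2 * (j + 1))) := by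
      gcongr; omega
    exact Nat.le_of_mul_le_mul_right (h4.trans h5) (by positivity)

lemma sum_range_two_mul_of_odd_eq_zero {f : ℕ → ℝ} (hf : ∀ j, f (2 * j + 1) = 0) (k : ℕ) :
    ∑ m ∈ range (2 * k + 1), f m = ∑ j ∈ range (k + 1), f (2 * j) := by
  induction k with
  | zero => simp
  | succ k ih =>
    rw [sum_range_succ _ (k + 1), ← ih, show 2 * (k + 1) + 1 = 2 * k + 1 + 1 + 1 by ring,
      sum_range_succ, sum_range_succ _ (2 * k + 1), hf]
    simp [mul_add]

/-- The two-point hypercontractive inequality for an even exponent. -/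
lemma add_pow_add_sub_pow_le (k : ℕ) (g h : ℝ) :
    (g + h) ^ (2 * k) + (g - h) ^ (2 * k) ≤ 2 * (g ^ 2 + 2 * k * h ^ 2) ^ k := by
  have e1 : (g + h) ^ (2 * k) + (g - h) ^ (2 * k) = ∑ m ∈ range (2 * k + 1),
      (h ^ m + (-h) ^ m) * g ^ (2 * k - m) * (2 * k).choose m := by
    rw [add_comm g h, sub_eq_neg_add, add_pow, add_pow, ← sum_add_distrib]
    exact sum_congr rfl fun m _ => by ring
  rw [e1, sum_range_two_mul_of_odd_eq_zero
    (f := fun m => (h ^ m + (-h) ^ m) * g ^ (2 * k - m) * (2 * k).choose m), add_comm (g ^ 2),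
    add_pow, mul_sum]
  · refine sum_le_sum fun j hj => ?_
    have hc : ((2 * k).choose (2 * j) : ℝ) ≤ (2 * k) ^ j * k.choose j := by
      exact_mod_cast choose_two_mul_le k j
    have e2 : (h ^ (2 * j) + (-h) ^ (2 * j)) * g ^ (2 * k - 2 * j)
        = 2 * ((h ^ 2) ^ j * (g ^ 2) ^ (k - j)) := by
      rw [(even_two_mul j).neg_pow, ← Nat.mul_sub, pow_mul, pow_mul]; ring
    rw [e2]
    calc 2 * ((h ^ 2) ^ j * (g ^ 2) ^ (k - j)) * ((2 * k).choose (2 * j) : ℝ)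
        ≤ 2 * ((h ^ 2) ^ j * (g ^ 2) ^ (k - j)) * ((2 * k) ^ j * k.choose j) := by gcongr
      _ = _ := by rw [mul_pow]; ring
  · intro j
    rw [(odd_two_mul_add_one j).neg_pow]
    simp

/-- Minkowski's inequality for `k`-th powers, stated without roots. -/
lemma sum_add_pow_le {A : Type*} (s : Finset A) {k : ℕ} (hk : k ≠ 0) {u v : A → ℝ} {m U V : ℝ}
    (hu : ∀ a ∈ s, 0 ≤ u a) (hv : ∀ a ∈ s, 0 ≤ v a) (hU : 0 ≤ U) (hV : 0 ≤ V)
    (h1 : ∑ a ∈ s, u a ^ k ≤ m * U ^ k) (h2 : ∑ a ∈ s, v a ^ k ≤ m * V ^ k) :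
    ∑ a ∈ s, (u a + v a) ^ k ≤ m * (U + V) ^ k := by
  have vanish : ∀ {f : A → ℝ}, (∀ a ∈ s, 0 ≤ f a) → ∑ a ∈ s, f a ^ k ≤ m * 0 ^ k →
      ∀ a ∈ s, f a = 0 := by
    intro f hf h a ha
    rw [zero_pow hk, mul_zero] at h
    have h0 := (sum_eq_zero_iff_of_nonneg fun a ha => pow_nonneg (hf a ha) k).1
      (le_antisymm h (sum_nonneg fun a ha => pow_nonneg (hf a ha) k)) a ha
    exact eq_zero_of_pow_eq_zero h0
  rcases hU.eq_or_lt with rfl | hU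
  · have := vanish hu h1
    rw [zero_add]
    exact (sum_congr rfl fun a ha => by rw [this a ha, zero_add]).trans_le h2
  rcases hV.eq_or_lt with rfl | hV
  · have := vanish hv h2
    rw [add_zero]
    exact (sum_congr rfl fun a ha => by rw [this a ha, add_zero]).trans_le h1
  have key : ∀ a ∈ s, (u a + v a) ^ k ≤
      (U + V) ^ k * (U / (U + V) * (u a ^ k / U ^ k) + V / (U + V) * (v a ^ k / V ^ k)) := by
    intro a ha
    have hc := (convexOn_pow (𝕜 := ℝ) k).2 (Set.mem_Ici.2 (div_nonneg (hu a ha) hU.le))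
      (Set.mem_Ici.2 (div_nonneg (hv a ha) hV.le)) (show 0 ≤ U / (U + V) by positivity)
      (show 0 ≤ V / (U + V) by positivity) (by field_simp)
    simp only [smul_eq_mul] at hc
    rw [div_pow, div_pow] at hc
    refine le_trans (le_of_eq ?_) (mul_le_mul_of_nonneg_left hc (by positivity))
    rw [← mul_pow]
    congr 1
    field_simp
  refine (sum_le_sum key).trans ?_
  rw [← mul_sum, sum_add_distrib, ← mul_sum, ← mul_sum, ← sum_div, ← sum_div, mul_comm m]
  refine mul_le_mul_of_nonneg_left ?_ (by positivity)
  have h1' : (∑ a ∈ s, u a ^ k) / U ^ k ≤ m := by rwa [div_le_iff₀ (by positivity)]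
  have h2' : (∑ a ∈ s, v a ^ k) / V ^ k ≤ m := by rwa [div_le_iff₀ (by positivity)]
  calc _ ≤ U / (U + V) * m + V / (U + V) * m := by gcongr
    _ = m := by field_simp

section Moments

variable {ι : Type*} [DecidableEq ι]

lemma sgn_sq (x : Finset ι) (i : ι) : sgn x i ^ 2 = 1 := by
  unfold sgn; split_ifs <;> norm_num

lemma sgn_symmDiff_self (x : Finset ι) (a : ι) : sgn (symmDiff x {a}) a = -sgn x a := by
  unfold sgn
  by_cases h : a ∈ x <;> simp [Finset.mem_symmDiff, h]

lemma sgn_symmDiff_of_ne (x : Finset ι) {a i : ι} (h : i ≠ a) :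
    sgn (symmDiff x {a}) i = sgn x i := by
  unfold sgn
  by_cases h' : i ∈ x <;> simp [Finset.mem_symmDiff, h, h']

lemma walsh_symmDiff_of_notMem (x : Finset ι) {S : Finset ι} {a : ι} (h : a ∉ S) :
    walsh S (symmDiff x {a}) = walsh S x :=
  prod_congr rfl fun _ hi => sgn_symmDiff_of_ne x fun hia => h (hia ▸ hi)

lemma walsh_eq_or (S x : Finset ι) : walsh S x = 1 ∨ walsh S x = -1 := by
  have h : walsh S x ^ 2 = 1 := by
    unfold walsh; rw [← prod_pow]; exact prod_eq_one fun i _ => sgn_sq x i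
  exact sq_eq_one_iff.1 h

variable [Fintype ι]

/-- Bonami's hypercontractive inequality for the moment of order `2 * k` of a polynomial on the
discrete cube, with the noise operator moved to the right-hand side: the coefficients of degree
`d` are weighted by `(2 * k) ^ d`. -/
lemma sum_walsh_pow_le {k : ℕ} (hk : k ≠ 0) (I : Finset ι) (c : Finset ι → ℝ) :
    ∑ x : Finset ι, (∑ S ∈ I.powerset, c S * walsh S x) ^ (2 * k) ≤
      2 ^ Fintype.card ι * (∑ S ∈ I.powerset, (2 * k : ℝ) ^ #S * c S ^ 2) ^ k := by
  induction I using Finset.induction_on generalizing c with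
  | empty => simp [walsh, pow_mul]
  | insert a I ha ih =>
    set g : Finset ι → ℝ := fun x => ∑ S ∈ I.powerset, c S * walsh S x with hg
    set h : Finset ι → ℝ := fun x => ∑ S ∈ I.powerset, c (insert a S) * walsh S x with hh
    have notMem : ∀ S ∈ I.powerset, a ∉ S := fun S hS haS => ha (mem_powerset.1 hS haS)
    have split : ∀ x, ∑ S ∈ (insert a I).powerset, c S * walsh S x = g x + sgn x a * h x := by
      intro x
      rw [sum_powerset_insert ha, hg, hh, mul_sum]
      congr 1
      refine sum_congr rfl fun S hS => ?_
      rw [walsh, prod_insert (notMem S hS), ← walsh]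
      ring
    have weight : ∑ S ∈ (insert a I).powerset, (2 * k : ℝ) ^ #S * c S ^ 2 =
        ∑ S ∈ I.powerset, (2 * k : ℝ) ^ #S * c S ^ 2 +
          2 * k * ∑ S ∈ I.powerset, (2 * k : ℝ) ^ #S * c (insert a S) ^ 2 := by
      rw [sum_powerset_insert ha, mul_sum]
      congr 1
      refine sum_congr rfl fun S hS => ?_
      rw [card_insert_of_notMem (notMem S hS)]
      ring
    -- averaging over the flip of the coordinate `a` removes the sign in front of `h`
    have flip : ∑ x, (g x + sgn x a * h x) ^ (2 * k) = ∑ x, (g x - sgn x a * h x) ^ (2 * k) := by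
      have inv : Function.Involutive fun x : Finset ι => symmDiff x {a} :=
        fun x => symmDiff_symmDiff_cancel_right {a} x
      refine Fintype.sum_equiv
        (Function.Involutive.toPerm (fun x : Finset ι => symmDiff x {a}) inv) _ _ fun x => ?_
      have h1 : g (symmDiff x {a}) = g x :=
        sum_congr rfl fun S hS => by rw [walsh_symmDiff_of_notMem x (notMem S hS)]
      have h2 : h (symmDiff x {a}) = h x :=
        sum_congr rfl fun S hS => by rw [walsh_symmDiff_of_notMem x (notMem S hS)]
      simp only [Function.Involutive.coe_toPerm]
      rw [h1, h2, sgn_symmDiff_self]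
      ring_nf
    have two : ∑ x, (g x + sgn x a * h x) ^ (2 * k) ≤ ∑ x, (g x ^ 2 + 2 * k * h x ^ 2) ^ k := by
      have : 2 * ∑ x, (g x + sgn x a * h x) ^ (2 * k) ≤
          2 * ∑ x, (g x ^ 2 + 2 * k * h x ^ 2) ^ k := by
        rw [two_mul, mul_sum]
        nth_rw 2 [flip]
        rw [← sum_add_distrib]
        refine sum_le_sum fun x _ => (add_pow_add_sub_pow_le k _ _).trans_eq ?_
        rw [mul_pow (sgn x a), sgn_sq, one_mul]
      linarith
    simp only [split, weight]
    refine two.trans ?_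
    refine sum_add_pow_le univ hk (fun x _ => sq_nonneg _) (fun x _ => by positivity)
      (sum_nonneg fun S _ => by positivity)
      (mul_nonneg (by positivity) (sum_nonneg fun S _ => by positivity)) ?_ ?_
    · simpa only [← pow_mul] using ih c
    · simp only [mul_pow (2 * k : ℝ)]
      rw [← mul_sum, mul_left_comm]
      refine mul_le_mul_of_nonneg_left ?_ (by positivity)
      simpa only [← pow_mul] using ih fun S => c (insert a S)

/-- Moment bound for a combination of distinct characters of degree at most `d`. -/
lemma sum_walsh_comp_pow_le {α : Type*} [Fintype α] {k : ℕ} (hk : k ≠ 0) {S : α → Finset ι}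
    (hS : Function.Injective S) {d : ℕ} (hd : ∀ a, #(S a) ≤ d) (c : α → ℝ) :
    ∑ x : Finset ι, (∑ a, c a * walsh (S a) x) ^ (2 * k) ≤
      2 ^ Fintype.card ι * ((2 * k) ^ d * ∑ a, c a ^ 2) ^ k := by
  classical
  let c' : Finset ι → ℝ := fun T => ∑ a, if S a = T then c a else 0
  have hc' : ∀ a, c' (S a) = c a := fun a => by simp [c', hS.eq_iff]
  have hc0 : ∀ T, T ∉ Set.range S → c' T = 0 := fun T hT =>
    sum_eq_zero fun a _ => if_neg fun h => hT ⟨a, h⟩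
  have pull : ∀ f : Finset ι → ℝ, (∀ T, T ∉ Set.range S → f T = 0) →
      ∑ T ∈ (univ : Finset ι).powerset, f T = ∑ a, f (S a) := by
    intro f hf
    rw [powerset_univ]
    exact (Fintype.sum_of_injective S hS _ _ hf fun _ => rfl).symm
  have h := sum_walsh_pow_le hk (univ : Finset ι) c'
  rw [pull (fun T => (2 * k : ℝ) ^ #T * c' T ^ 2) fun T hT => by simp [hc0 T hT]] at h
  simp only [fun x => pull (fun T => c' T * walsh T x) fun T hT => by simp [hc0 T hT], hc'] at h
  refine h.trans ?_
  gcongr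
  rw [mul_sum]
  refine sum_le_sum fun a _ => ?_
  gcongr
  · have : (1 : ℝ) ≤ k := by exact_mod_cast Nat.one_le_iff_ne_zero.2 hk
    linarith
  · exact hd a

end Moments

/-! ### Finite memory and random letters with a hidden parameter -/

/-- The expected value of `g` at the state reached from the state `q` at time `t` by `T` further
steps of the transition rule `upd` on independent letters of law `p`. -/
noncomputable def streamExpect {α Q : Type*} [Fintype α] (p : α → ℝ) (upd : ℕ → Q → α → Q)
    (g : Q → ℝ) : ℕ → ℕ → Q → ℝ
  | 0, _, q => g q
  | T + 1, t, q => ∑ a, p a * streamExpect p upd g T (t + 1) (upd t q a)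

section StreamExpect

variable {α Q : Type*} [Fintype α] {p : α → ℝ} {upd : ℕ → Q → α → Q}

lemma streamExpect_nonneg (hp : ∀ a, 0 ≤ p a) {g : Q → ℝ} (hg : ∀ q, 0 ≤ g q) (T t : ℕ) (q : Q) :
    0 ≤ streamExpect p upd g T t q := by
  induction T generalizing t q with
  | zero => exact hg q
  | succ T ih => exact sum_nonneg fun a _ => mul_nonneg (hp a) (ih _ _)

lemma streamExpect_pos (hp : ∀ a, 0 ≤ p a) (hp1 : ∑ a, p a = 1) {g : Q → ℝ} (hg : ∀ q, 0 < g q)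
    (T t : ℕ) (q : Q) : 0 < streamExpect p upd g T t q := by
  induction T generalizing t q with
  | zero => exact hg q
  | succ T ih =>
    obtain ⟨a, ha, hpa⟩ := exists_ne_zero_of_sum_ne_zero (hp1.trans_ne one_ne_zero)
    exact sum_pos' (fun a _ => mul_nonneg (hp a) (ih _ _).le)
      ⟨a, ha, mul_pos ((hp a).lt_of_ne' hpa) (ih _ _)⟩

lemma streamExpect_const_add_mul (hp1 : ∑ a, p a = 1) (c d : ℝ) (g : Q → ℝ) (T t : ℕ) (q : Q) :
    streamExpect p upd (fun q => c + d * g q) T t q = c + d * streamExpect p upd g T t q := by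
  induction T generalizing t q with
  | zero => rfl
  | succ T ih =>
    simp only [streamExpect, ih, mul_add, sum_add_distrib, ← sum_mul, hp1, one_mul, mul_sum]
    congr 1
    exact sum_congr rfl fun a _ => by ring

end StreamExpect

section Bias

variable {α θ : Type*} [Fintype α] {Θ : Finset θ} {z : θ → α → ℝ} {k : ℕ} {κ D : ℝ}

/-- A level inequality: if the linear combinations of the signs `z · a` have small moments of
order `2 * k` over `Θ`, then a weight `w ≤ 1` on `Θ` that is not too small induces small
biases of these signs. The biases and the mass of `w` are not normalized. The factor `κ` is meant
to be the square of `2 * k`, and `D` the size of `Θ` divided by its density in the cube. -/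
lemma sum_bias_sq_le (hk : k ≠ 0) (hκ : 0 < κ) (hD0 : 0 ≤ D)
    (hD : ∀ c : α → ℝ, ∑ x ∈ Θ, (∑ a, c a * z x a) ^ (2 * k) ≤ D * (κ * ∑ a, c a ^ 2) ^ k)
    {w : θ → ℝ} (hw0 : ∀ x ∈ Θ, 0 ≤ w x) (hw1 : ∀ x ∈ Θ, w x ≤ 1) (hm : 0 < ∑ x ∈ Θ, w x) :
    ∑ a, (∑ x ∈ Θ, w x * z x a) ^ 2 ≤
      2 * κ * (∑ x ∈ Θ, w x) * (∑ x ∈ Θ, w x + D / 2 ^ k) := by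
  set m := ∑ x ∈ Θ, w x with hmdef
  set b : α → ℝ := fun a => (∑ x ∈ Θ, w x * z x a) / m with hb
  set W := ∑ a, b a ^ 2 with hW
  have hWB : ∑ a, (∑ x ∈ Θ, w x * z x a) ^ 2 = m ^ 2 * W := by
    rw [hW, mul_sum]
    refine sum_congr rfl fun a _ => ?_
    simp only [hb]
    field_simp
  have hW0 : 0 ≤ W := sum_nonneg fun a _ => sq_nonneg _
  -- `W` is itself the mean of a linear combination of the signs
  have hWmean : W = ∑ x ∈ Θ, w x / m * ∑ a, b a * z x a := by
    simp only [mul_sum]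
    rw [sum_comm, hW]
    refine sum_congr rfl fun a _ => ?_
    rw [sq]
    nth_rw 2 [hb]
    simp only [sum_div, mul_sum]
    exact sum_congr rfl fun x _ => by ring
  have hpow : W ^ (2 * k) ≤ D / m * (κ * W) ^ k := by
    calc W ^ (2 * k) ≤ ∑ x ∈ Θ, w x / m * (∑ a, b a * z x a) ^ (2 * k) := by
          nth_rw 1 [hWmean]
          refine Real.pow_arith_mean_le_arith_mean_pow_of_even Θ _ _
            (fun x hx => div_nonneg (hw0 x hx) hm.le) ?_ (even_two_mul k)
          rw [← sum_div, div_self hm.ne']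
      _ ≤ ∑ x ∈ Θ, 1 / m * (∑ a, b a * z x a) ^ (2 * k) := by
          refine sum_le_sum fun x hx => mul_le_mul_of_nonneg_right ?_
            ((even_two_mul k).pow_nonneg _)
          exact div_le_div_of_nonneg_right (hw1 x hx) hm.le
      _ ≤ 1 / m * (D * (κ * W) ^ k) := by
          rw [← mul_sum]
          exact mul_le_mul_of_nonneg_left (hD b) (by positivity)
      _ = D / m * (κ * W) ^ k := by ring
  -- `y ≤ 1 + y ^ k` replaces a `k`-th root by a bound that can be summed over weights `w`
  have hy : W / (2 * κ) ≤ 1 + D / 2 ^ k / m := by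
    rcases le_or_gt (W / (2 * κ)) 1 with h1 | h1
    · have : 0 ≤ D / 2 ^ k / m := by positivity
      linarith
    · have hWpos : 0 < W := by
        by_contra h
        have : W = 0 := le_antisymm (not_lt.1 h) hW0
        rw [this] at h1; norm_num at h1
      have h2 : W ^ k ≤ D / m * κ ^ k := by
        rw [mul_pow, two_mul, pow_add, ← mul_assoc] at hpow
        exact le_of_mul_le_mul_right hpow (by positivity)
      calc W / (2 * κ) ≤ (W / (2 * κ)) ^ k := le_self_pow₀ h1.le hk
        _ = W ^ k / (2 ^ k * κ ^ k) := by rw [div_pow, mul_pow]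
        _ ≤ D / m * κ ^ k / (2 ^ k * κ ^ k) := by gcongr
        _ = D / 2 ^ k / m := by field_simp
        _ ≤ _ := by linarith
  rw [hWB]
  rw [div_le_iff₀ (by positivity)] at hy
  calc m ^ 2 * W ≤ m ^ 2 * ((1 + D / 2 ^ k / m) * (2 * κ)) := by gcongr
    _ = _ := by field_simp

/-- Gibbs' variational inequality against the uniform law, with the relative entropy of the
weight `J` of total mass `m` bounded by its `χ²`-divergence. -/
lemma sum_mul_le_log_add [Nonempty α] {J V : α → ℝ} {m : ℝ} (hm : 0 < m) (hJ : ∀ a, 0 ≤ J a)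
    (hJm : ∑ a, J a = m) :
    ∑ a, J a * V a ≤ m * Real.log (∑ a, (Fintype.card α : ℝ)⁻¹ * Real.exp (V a)) +
      (Fintype.card α * (∑ a, J a ^ 2) / m - m) := by
  set N : ℝ := (Fintype.card α : ℝ) with hN
  have hN0 : 0 < N := by rw [hN]; exact_mod_cast Fintype.card_pos
  set Z := ∑ a, N⁻¹ * Real.exp (V a) with hZ
  have hZ0 : 0 < Z := sum_pos (fun a _ => by positivity) univ_nonempty
  -- from `log y ≤ y - 1` for the two factors of `exp (V a) / Z`, through `N * J a / m`
  have key : ∀ a, J a * (V a - Real.log Z) ≤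
      m * (N⁻¹ * Real.exp (V a)) / Z + N * J a ^ 2 / m - 2 * J a := by
    intro a
    rcases (hJ a).eq_or_lt with h | h
    · rw [← h]; simp; positivity
    · have h1 := Real.log_le_sub_one_of_pos
        (show 0 < m * (N⁻¹ * Real.exp (V a)) / Z / J a by positivity)
      have h2 := Real.log_le_sub_one_of_pos (show 0 < N * J a / m by positivity)
      have h3 : V a - Real.log Z = Real.log (m * (N⁻¹ * Real.exp (V a)) / Z / J a) +
          Real.log (N * J a / m) := by
        rw [← Real.log_mul (by positivity) (by positivity), ← Real.log_exp (V a),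
          ← Real.log_div (by positivity) (by positivity)]
        congr 1
        rw [Real.log_exp]
        field_simp
      calc J a * (V a - Real.log Z)
          ≤ J a * ((m * (N⁻¹ * Real.exp (V a)) / Z / J a - 1) + (N * J a / m - 1)) := by
            rw [h3]; gcongr
        _ = _ := by field_simp; ring
  have hsum := sum_le_sum fun a (_ : a ∈ univ) => key a
  simp only [mul_sub, sum_sub_distrib, sum_add_distrib] at hsum
  rw [← sum_mul, ← sum_div, ← sum_div, ← mul_sum, ← hZ, ← mul_sum, ← mul_sum, hJm,
    mul_div_cancel_right₀ _ hZ0.ne'] at hsum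
  linarith

variable {M : ℝ}

/-- The cost of one letter at one memory state: `w x` is the probability of the state
under the parameter `x`, and the letter has law `(1 + z x a) / (2 * M)`. -/
lemma sum_letter_le [Nonempty α] (hk : k ≠ 0) (hκ : 0 < κ) (hD0 : 0 ≤ D)
    (hD : ∀ c : α → ℝ, ∑ x ∈ Θ, (∑ a, c a * z x a) ^ (2 * k) ≤ D * (κ * ∑ a, c a ^ 2) ^ k)
    (hM : (Fintype.card α : ℝ) ≤ 2 * M)
    (hz : ∀ x ∈ Θ, ∀ a, 0 ≤ 1 + z x a) (hz1 : ∀ x ∈ Θ, ∑ a, (1 + z x a) / (2 * M) = 1)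
    {w : θ → ℝ} (hw0 : ∀ x ∈ Θ, 0 ≤ w x) (hw1 : ∀ x ∈ Θ, w x ≤ 1) (V : α → ℝ) :
    ∑ a, (∑ x ∈ Θ, w x * ((1 + z x a) / (2 * M))) * V a ≤
      (∑ x ∈ Θ, w x) * Real.log (∑ a, (Fintype.card α : ℝ)⁻¹ * Real.exp (V a)) +
      2 * κ / Fintype.card α * (∑ x ∈ Θ, w x + D / 2 ^ k) := by
  set N : ℝ := (Fintype.card α : ℝ) with hN
  have hN0 : 0 < N := by rw [hN]; exact_mod_cast Fintype.card_pos
  have hM0 : 0 < M := by linarith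
  rcases (sum_nonneg hw0).eq_or_lt with hm | hm
  · have h0 : ∀ x ∈ Θ, w x = 0 := (sum_eq_zero_iff_of_nonneg hw0).1 hm.symm
    rw [← hm, sum_eq_zero fun a _ => by
      rw [sum_eq_zero fun x hx => by rw [h0 x hx, zero_mul], zero_mul], zero_mul, zero_add, zero_add]
    positivity
  set m := ∑ x ∈ Θ, w x with hmdef
  set J : α → ℝ := fun a => ∑ x ∈ Θ, w x * ((1 + z x a) / (2 * M)) with hJ
  have hJm : ∑ a, J a = m := by
    rw [hJ, sum_comm]
    exact sum_congr rfl fun x hx => by rw [← mul_sum, hz1 x hx, mul_one]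
  refine (sum_mul_le_log_add hm (fun a => sum_nonneg fun x hx => mul_nonneg (hw0 x hx)
    (div_nonneg (hz x hx a) (by positivity))) hJm).trans ?_
  gcongr
  have hB := sum_bias_sq_le hk hκ hD0 hD hw0 hw1 hm
  rw [← hmdef] at hB
  have hBJ : ∀ a, ∑ x ∈ Θ, w x * z x a = 2 * M * J a - m := by
    intro a
    rw [hJ, hmdef, mul_sum, ← sum_sub_distrib]
    exact sum_congr rfl fun x _ => by field_simp; ring
  have hB2 : ∑ a, (∑ x ∈ Θ, w x * z x a) ^ 2 =
      4 * M ^ 2 * ∑ a, J a ^ 2 - 4 * M * m ^ 2 + N * m ^ 2 := by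
    have : ∀ a, (∑ x ∈ Θ, w x * z x a) ^ 2 =
        4 * M ^ 2 * J a ^ 2 - 4 * M * m * J a + m ^ 2 := fun a => by rw [hBJ]; ring
    simp only [this, sum_add_distrib, sum_sub_distrib, ← mul_sum, hJm]
    rw [sum_const, card_univ, nsmul_eq_mul]
    ring
  rw [hB2] at hB
  set Q2 := ∑ a, J a ^ 2 with hQ2
  set r := m + D / 2 ^ k with hr
  have hr0 : 0 ≤ r := by positivity
  rw [← hN, sub_le_iff_le_add, div_le_iff₀ hm]
  -- `N * Q2 - m ^ 2` is at most the squared distance of `J` to the constant `m / (2 * M)`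
  have h1 : N * (4 * M ^ 2 * Q2 - 4 * M * m ^ 2 + N * m ^ 2) =
      4 * M ^ 2 * (N * Q2 - m ^ 2) + m ^ 2 * (2 * M - N) ^ 2 := by ring
  have h2 : 4 * M ^ 2 * (N * Q2 - m ^ 2) ≤ N * (2 * κ * m * r) := by
    have := mul_le_mul_of_nonneg_left hB hN0.le
    have h3 : 0 ≤ m ^ 2 * (2 * M - N) ^ 2 := by positivity
    linarith
  have h4 : N ^ 2 * (2 * κ / N * r * m) ≤ 4 * M ^ 2 * (2 * κ / N * r * m) := by
    have : N ^ 2 ≤ 4 * M ^ 2 := by nlinarith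
    gcongr
  have h5 : N ^ 2 * (2 * κ / N * r * m) = N * (2 * κ * m * r) := by field_simp
  have h6 : 4 * M ^ 2 * (N * Q2 - m ^ 2) ≤ 4 * M ^ 2 * (2 * κ / N * r * m) := by linarith
  have h7 := le_of_mul_le_mul_left h6 (by positivity)
  linarith

variable {Q : Type*} [Fintype Q]

/-- The chain rule: along the stream, the exponential functional of the uniform stream dominates
the mean over the streams with hidden parameter `x ∈ Θ`, up to an error that is additive in the
number of letters. Here `w x q` is the probability of the state `q` at time `t`. -/
lemma sum_streamExpect_le_log [Nonempty α] (hk : k ≠ 0) (hκ : 0 < κ) (hD0 : 0 ≤ D)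
    (hD : ∀ c : α → ℝ, ∑ x ∈ Θ, (∑ a, c a * z x a) ^ (2 * k) ≤ D * (κ * ∑ a, c a ^ 2) ^ k)
    (hM : (Fintype.card α : ℝ) ≤ 2 * M)
    (hz : ∀ x ∈ Θ, ∀ a, 0 ≤ 1 + z x a) (hz1 : ∀ x ∈ Θ, ∑ a, (1 + z x a) / (2 * M) = 1)
    (upd : ℕ → Q → α → Q) (g : Q → ℝ) (T t : ℕ)
    (w : θ → Q → ℝ) (hw0 : ∀ x ∈ Θ, ∀ q, 0 ≤ w x q) (hw1 : ∀ x ∈ Θ, ∑ q, w x q = 1) :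
    ∑ q, ∑ x ∈ Θ, w x q * streamExpect (fun a => (1 + z x a) / (2 * M)) upd g T t q ≤
      T * (2 * κ / Fintype.card α * (#Θ + Fintype.card Q * (D / 2 ^ k))) +
      ∑ q, (∑ x ∈ Θ, w x q) * Real.log (streamExpect (fun _ => (Fintype.card α : ℝ)⁻¹) upd
        (fun q => Real.exp (g q)) T t q) := by
  classical
  have hM0 : 0 < M := by
    have : (0 : ℝ) < Fintype.card α := by exact_mod_cast Fintype.card_pos
    linarith
  set u : α → ℝ := fun _ => (Fintype.card α : ℝ)⁻¹ with hu
  have hu1 : ∑ a, u a = 1 := by simp [hu]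
  induction T generalizing t w with
  | zero => simp [streamExpect, sum_mul]
  | succ T ih =>
    set β := 2 * κ / Fintype.card α * (#Θ + Fintype.card Q * (D / 2 ^ k)) with hβ
    -- the law of the next state
    let w' : θ → Q → ℝ := fun x q' =>
      ∑ q, ∑ a, if upd t q a = q' then w x q * ((1 + z x a) / (2 * M)) else 0
    have push : ∀ (x : θ) (F : Q → ℝ), ∑ q', w' x q' * F q' =
        ∑ q, ∑ a, w x q * ((1 + z x a) / (2 * M)) * F (upd t q a) := by
      intro x F
      simp only [w', sum_mul, ite_mul, zero_mul]
      rw [sum_comm]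
      refine sum_congr rfl fun q _ => ?_
      rw [sum_comm]
      exact sum_congr rfl fun a _ => by simp
    have h0 : ∀ x ∈ Θ, ∀ q, 0 ≤ w' x q := fun x hx q => sum_nonneg fun q' _ =>
      sum_nonneg fun a _ => by
        split_ifs
        · exact mul_nonneg (hw0 x hx q') (div_nonneg (hz x hx a) (by positivity))
        · exact le_rfl
    have h1 : ∀ x ∈ Θ, ∑ q, w' x q = 1 := by
      intro x hx
      have := push x fun _ => 1
      simp only [mul_one] at this
      rw [this]
      exact (sum_congr rfl fun q _ => by rw [← mul_sum, hz1 x hx, mul_one]).trans (hw1 x hx)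
    have hle1 : ∀ q, ∀ x ∈ Θ, w x q ≤ 1 := fun q x hx =>
      (single_le_sum (fun q _ => hw0 x hx q) (mem_univ q)).trans_eq (hw1 x hx)
    have hlog : ∀ q, ∀ a, Real.exp (Real.log (streamExpect u upd (fun q => Real.exp (g q)) T (t + 1)
        (upd t q a))) = streamExpect u upd (fun q => Real.exp (g q)) T (t + 1) (upd t q a) :=
      fun q a => Real.exp_log (streamExpect_pos (fun _ => by positivity) hu1
        (fun q => Real.exp_pos _) _ _ _)
    calc ∑ q, ∑ x ∈ Θ, w x q * streamExpect (fun a => (1 + z x a) / (2 * M)) upd g (T + 1) t q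
        = ∑ q', ∑ x ∈ Θ, w' x q' *
            streamExpect (fun a => (1 + z x a) / (2 * M)) upd g T (t + 1) q' := by
          rw [sum_comm, sum_comm (s := univ)]
          refine sum_congr rfl fun x _ => ?_
          rw [push]
          refine sum_congr rfl fun q _ => ?_
          rw [streamExpect, mul_sum]
          exact sum_congr rfl fun a _ => by ring
      _ ≤ T * β + ∑ q', (∑ x ∈ Θ, w' x q') * Real.log (streamExpect u upd
            (fun q => Real.exp (g q)) T (t + 1) q') := ih (t + 1) w' h0 h1
      _ = T * β + ∑ q, ∑ a, (∑ x ∈ Θ, w x q * ((1 + z x a) / (2 * M))) * Real.log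
            (streamExpect u upd (fun q => Real.exp (g q)) T (t + 1) (upd t q a)) := by
          congr 1
          simp only [sum_mul]
          rw [sum_comm]
          simp only [push]
          rw [sum_comm]
          exact sum_congr rfl fun q _ => sum_comm
      _ ≤ T * β + ∑ q, ((∑ x ∈ Θ, w x q) * Real.log (streamExpect u upd
            (fun q => Real.exp (g q)) (T + 1) t q) +
            2 * κ / Fintype.card α * (∑ x ∈ Θ, w x q + D / 2 ^ k)) := by
          gcongr with q
          refine (sum_letter_le hk hκ hD0 hD hM hz hz1 (fun x hx => hw0 x hx q) (hle1 q) _).trans ?_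
          simp only [hlog]
          exact le_rfl
      _ = _ := by
          rw [sum_add_distrib, ← mul_sum, sum_add_distrib, sum_comm (s := univ) (t := Θ),
            sum_congr rfl hw1, hβ]
          simp only [sum_const, card_univ, nsmul_eq_mul]
          push_cast
          ring

/-- A memory of few states cannot tell the streams with a random hidden parameter `x ∈ Θ` from
the uniform stream: comparison of the probabilities of an event. The test function is `1 / 2` on the
event and `0` off it, and the factor `13 / 10` is an upper bound of `2 * (exp (1 / 2) - 1)`. -/
theorem sum_streamExpect_indicator_le [Nonempty α] (hk : k ≠ 0) (hκ : 0 < κ) (hD0 : 0 ≤ D)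
    (hD : ∀ c : α → ℝ, ∑ x ∈ Θ, (∑ a, c a * z x a) ^ (2 * k) ≤ D * (κ * ∑ a, c a ^ 2) ^ k)
    (hM : (Fintype.card α : ℝ) ≤ 2 * M)
    (hz : ∀ x ∈ Θ, ∀ a, 0 ≤ 1 + z x a) (hz1 : ∀ x ∈ Θ, ∑ a, (1 + z x a) / (2 * M) = 1)
    (upd : ℕ → Q → α → Q) (F : Set Q) (T : ℕ) (q₀ : Q) :
    ∑ x ∈ Θ, streamExpect (fun a => (1 + z x a) / (2 * M)) upd (F.indicator 1) T 0 q₀ ≤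
      2 * T * (2 * κ / Fintype.card α * (#Θ + Fintype.card Q * (D / 2 ^ k))) +
      #Θ * (13 / 10 * streamExpect (fun _ => (Fintype.card α : ℝ)⁻¹) upd (F.indicator 1) T 0 q₀) := by
  classical
  set u : α → ℝ := fun _ => (Fintype.card α : ℝ)⁻¹ with hu
  have hu1 : ∑ a, u a = 1 := by simp [hu]
  have h := sum_streamExpect_le_log hk hκ hD0 hD hM hz hz1 upd
    (fun q => 0 + 1 / 2 * F.indicator 1 q) T 0
    (fun _ => Pi.single q₀ 1) (fun x _ q => by by_cases hq : q = q₀ <;> simp [hq])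
    (fun x _ => by simp)
  have hexp : (fun q => Real.exp (0 + 1 / 2 * F.indicator (1 : Q → ℝ) q)) =
      fun q => 1 + (Real.exp (1 / 2) - 1) * F.indicator 1 q := by
    ext q
    by_cases hq : q ∈ F <;> simp [hq]
  have hexp2 : Real.exp (1 / 2) ≤ 33 / 20 := by
    have h1 : Real.exp (1 / 2) ^ 2 ≤ (33 / 20) ^ 2 := by
      rw [← Real.exp_nat_mul]
      have := Real.exp_one_lt_d9
      norm_num at this ⊢
      linarith
    exact le_of_sq_le_sq h1 (by norm_num)
  rw [hexp] at h
  have hs0 : 0 ≤ streamExpect u upd (F.indicator 1) T 0 q₀ :=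
    streamExpect_nonneg (fun _ => by positivity)
      (fun q => Set.indicator_nonneg (fun _ _ => zero_le_one) q) _ _ _
  have hlog : Real.log (streamExpect u upd (fun q => 1 + (Real.exp (1 / 2) - 1) * F.indicator 1 q)
      T 0 q₀) ≤ 13 / 20 * streamExpect u upd (F.indicator 1) T 0 q₀ := by
    rw [streamExpect_const_add_mul hu1]
    have he : 0 ≤ Real.exp (1 / 2) - 1 := by
      have := Real.add_one_le_exp (1 / 2 : ℝ); linarith
    refine (Real.log_le_sub_one_of_pos (by positivity)).trans ?_
    rw [add_sub_cancel_left]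
    gcongr
    linarith
  have hl : ∀ G : Q → ℝ, ∑ q, (∑ x ∈ Θ, (Pi.single q₀ 1 : Q → ℝ) q) * G q = #Θ * G q₀ := by
    intro G
    rw [sum_eq_single q₀] <;> simp +contextual
  have hl' : ∀ G : θ → Q → ℝ, ∑ q, ∑ x ∈ Θ, (Pi.single q₀ 1 : Q → ℝ) q * G x q
      = ∑ x ∈ Θ, G x q₀ := by
    intro G
    rw [sum_eq_single q₀] <;> simp +contextual
  rw [hl, hl'] at h
  rw [sum_congr rfl fun x hx => streamExpect_const_add_mul (hz1 x hx) 0 (1 / 2) _ _ _ _] at h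
  simp only [zero_add, ← mul_sum] at h
  have h2 := mul_le_mul_of_nonneg_left hlog (Nat.cast_nonneg (α := ℝ) #Θ)
  linarith

end Bias

/-! ### Bipartite graphs and random graphs -/

/-- The pairs of distinct vertices in `Fin n`. -/
abbrev Pair (n : ℕ) : Type := {e : Sym2 (Fin n) // ¬ e.IsDiag}

/-- The complete bipartite graph with sides `A` and `Aᶜ`. -/
def cutGraph {n : ℕ} (A : Finset (Fin n)) : SimpleGraph (Fin n) where
  Adj u v := ¬(u ∈ A ↔ v ∈ A)
  symm := ⟨fun _ _ h h' => h h'.symm⟩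
  loopless := ⟨fun _ h => h Iff.rfl⟩

/-- The graph with edge set `H`. -/
def pairGraph {n : ℕ} (H : Finset (Pair n)) : SimpleGraph (Fin n) :=
  SimpleGraph.fromEdgeSet (Subtype.val '' (H : Set (Pair n)))

section Graphs

variable {n : ℕ}

lemma adj_cutGraph {A : Finset (Fin n)} {u v : Fin n} :
    (cutGraph A).Adj u v ↔ ¬(u ∈ A ↔ v ∈ A) := Iff.rfl

lemma card_pair (n : ℕ) : Fintype.card (Pair n) = n.choose 2 := by
  rw [Sym2.card_subtype_not_diag, Fintype.card_fin]

lemma two_mul_card_pair (n : ℕ) : 2 * (Fintype.card (Pair n) : ℝ) = n * (n - 1) := by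
  rw [card_pair, Nat.cast_choose_two]; ring

lemma mem_edgeSet_cutGraph (A : Finset (Fin n)) (e : Pair n) :
    e.1 ∈ (cutGraph A).edgeSet ↔ walsh e.1.toFinset A = -1 := by
  obtain ⟨e, he⟩ := e
  induction e with
  | _ u v =>
    rw [Sym2.mk_isDiag_iff] at he
    rw [SimpleGraph.mem_edgeSet, Sym2.toFinset_mk_eq, walsh, prod_pair he]
    simp only [cutGraph, sgn]
    by_cases hu : u ∈ A <;> by_cases hv : v ∈ A <;> simp [hu, hv] <;> norm_num

lemma mem_edgeSet_pairGraph (H : Finset (Pair n)) (e : Pair n) :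
    e.1 ∈ (pairGraph H).edgeSet ↔ walsh {e} H = -1 := by
  rw [pairGraph, SimpleGraph.edgeSet_fromEdgeSet, walsh, prod_singleton, sgn]
  by_cases h : e ∈ H
  · simp [h, e.2]
  · have h1 : ¬ (1 : ℝ) = -1 := by norm_num
    simp [h, h1]

lemma toFinset_pair_injective : Function.Injective fun e : Pair n => e.1.toFinset := by
  intro e f h
  refine Subtype.ext (Sym2.ext fun x => ?_)
  rw [← Sym2.mem_toFinset, ← Sym2.mem_toFinset]
  exact (Finset.ext_iff.1 h) x

/-- The edges of a graph that cross a cut are the edges that it shares with `cutGraph`. -/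
lemma card_interedges_compl (G : SimpleGraph (Fin n)) [DecidableRel G.Adj] (A : Finset (Fin n))
    [DecidablePred fun e : Pair n => e.1 ∈ G.edgeSet ∧ e.1 ∈ (cutGraph A).edgeSet] :
    #(G.interedges A Aᶜ) =
      #{e : Pair n | e.1 ∈ G.edgeSet ∧ e.1 ∈ (cutGraph A).edgeSet} := by
  refine card_bij (fun p hp => ⟨s(p.1, p.2), ?_⟩) ?_ ?_ ?_
  · rw [SimpleGraph.mem_interedges_iff] at hp
    rw [Sym2.mk_isDiag_iff]
    exact hp.2.2.ne
  · intro p hp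
    rw [SimpleGraph.mem_interedges_iff, mem_compl] at hp
    simp only [mem_filter, mem_univ, true_and, SimpleGraph.mem_edgeSet, adj_cutGraph]
    tauto
  · rintro ⟨u, v⟩ hp ⟨u', v'⟩ hp' h
    rw [SimpleGraph.mem_interedges_iff, mem_compl] at hp hp'
    simp only [Subtype.mk.injEq, Sym2.eq_iff] at h
    rcases h with ⟨rfl, rfl⟩ | ⟨rfl, rfl⟩
    · rfl
    · exact absurd hp.1 hp'.2.1
  · rintro ⟨e, he⟩ h
    induction e with
    | _ u v =>
      simp only [mem_filter, mem_univ, true_and, SimpleGraph.mem_edgeSet, adj_cutGraph] at h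
      by_cases hu : u ∈ A
      · refine ⟨(u, v), ?_, rfl⟩
        rw [SimpleGraph.mem_interedges_iff, mem_compl]
        exact ⟨hu, fun hv => h.2 ⟨fun _ => hv, fun _ => hu⟩, h.1⟩
      · refine ⟨(v, u), ?_, Subtype.ext Sym2.eq_swap⟩
        rw [SimpleGraph.mem_interedges_iff, mem_compl]
        exact ⟨by_contra fun hv => h.2 ⟨fun h => (hu h).elim, fun h => (hv h).elim⟩, hu, h.1.symm⟩

open Classical in
lemma maxCut_eq_sup (G : SimpleGraph (Fin n)) : maxCut G = univ.sup fun A : Finset (Fin n) =>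
    #{e : Pair n | e.1 ∈ G.edgeSet ∧ e.1 ∈ (cutGraph A).edgeSet} := by
  unfold maxCut
  refine sup_congr rfl fun A _ => ?_
  convert card_interedges_compl G A

lemma card_edgeFinset_eq (G : SimpleGraph (Fin n)) [Fintype G.edgeSet]
    [DecidablePred fun e : Pair n => e.1 ∈ G.edgeSet] :
    #G.edgeFinset = #{e : Pair n | e.1 ∈ G.edgeSet} := by
  rw [← card_map (Function.Embedding.subtype _)]
  congr 1
  ext e
  simp only [SimpleGraph.mem_edgeFinset, mem_map, mem_filter, mem_univ, true_and,
    Function.Embedding.coe_subtype, Subtype.exists, exists_and_left]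
  constructor
  · exact fun h => ⟨e, h, G.not_isDiag_of_mem_edgeSet h, rfl⟩
  · rintro ⟨a, ha, _, rfl⟩
    exact ha

lemma card_edgeSet_cutGraph (A : Finset (Fin n))
    [DecidablePred fun e : Pair n => e.1 ∈ (cutGraph A).edgeSet] :
    #{e : Pair n | e.1 ∈ (cutGraph A).edgeSet} = #A * (n - #A) := by
  classical
  have h := card_interedges_compl (cutGraph A) A
  simp only [and_self] at h
  rw [show #{e : Pair n | e.1 ∈ (cutGraph A).edgeSet} = _ from Eq.trans (by congr) h.symm,
    SimpleGraph.interedges_def, filter_true_of_mem, card_product,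
    card_compl, Fintype.card_fin]
  rintro ⟨u, v⟩ hp
  rw [mem_product, mem_compl] at hp
  rw [adj_cutGraph]
  tauto

lemma le_maxCut_cutGraph (A : Finset (Fin n)) : #A * (n - #A) ≤ maxCut (cutGraph A) := by
  classical
  rw [maxCut_eq_sup]
  refine le_trans (le_of_eq ?_) (le_sup (mem_univ A))
  simp only [and_self]
  exact (card_edgeSet_cutGraph A).symm

lemma card_edgeSet_pairGraph (H : Finset (Pair n))
    [DecidablePred fun e : Pair n => e.1 ∈ (pairGraph H).edgeSet] :
    #{e : Pair n | e.1 ∈ (pairGraph H).edgeSet} = #H := by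
  congr 1
  ext e
  rw [mem_filter, mem_edgeSet_pairGraph, walsh, prod_singleton, sgn]
  by_cases h : e ∈ H
  · simp [h]
  · have h1 : ¬ (1 : ℝ) = -1 := by norm_num
    simp [h, h1]

lemma card_pairGraph_inter_cut (H : Finset (Pair n)) (A : Finset (Fin n)) [DecidablePred
      fun e : Pair n => e.1 ∈ (pairGraph H).edgeSet ∧ e.1 ∈ (cutGraph A).edgeSet] :
    2 * (#{e : Pair n | e.1 ∈ (pairGraph H).edgeSet ∧ e.1 ∈ (cutGraph A).edgeSet} : ℝ) =
      #A * (n - #A : ℕ) -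
        ∑ e : Pair n, Set.indicator {e | e.1 ∈ (cutGraph A).edgeSet} 1 e * walsh {e} H := by
  classical
  have h : ((#A * (n - #A) : ℕ) : ℝ) =
      ∑ e : Pair n, Set.indicator {e : Pair n | e.1 ∈ (cutGraph A).edgeSet} (1 : Pair n → ℝ) e := by
    rw [← card_edgeSet_cutGraph A, card_filter]
    push_cast
    exact sum_congr rfl fun e _ => by simp [Set.indicator_apply]
  rw [← Nat.cast_mul, h, ← sum_sub_distrib, card_filter]
  push_cast
  rw [mul_sum]
  refine sum_congr rfl fun e _ => ?_
  rcases walsh_eq_or {e} H with h1 | h1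
  · have : e.1 ∉ (pairGraph H).edgeSet := by
      rw [mem_edgeSet_pairGraph, h1]; norm_num
    simp [this, h1]
  · have : e.1 ∈ (pairGraph H).edgeSet := by
      rw [mem_edgeSet_pairGraph, h1]
    by_cases h2 : e.1 ∈ (cutGraph A).edgeSet <;> simp [this, h1, h2]; norm_num

lemma mul_sub_le_sq_div_four (A : Finset (Fin n)) :
    (#A : ℝ) * (n - #A : ℕ) ≤ (n : ℝ) ^ 2 / 4 := by
  have : #A ≤ n := by simpa using card_le_univ A
  rw [Nat.cast_sub this]
  nlinarith [sq_nonneg ((n : ℝ) - 2 * #A)]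

/-- For a uniformly random set `H` of pairs, a fixed cut is unlikely to be much larger than
expected: Markov's inequality for the moment of order `2 * n` of the sum of the signs over the
cut. -/
lemma card_filter_large_cut_le {τ : ℝ} (hτ : 0 < τ) (hn : n ≠ 0) (A : Finset (Fin n)) :
    (#{H : Finset (Pair n) | ∑ e : Pair n, Set.indicator {e | e.1 ∈ (cutGraph A).edgeSet} 1 e *
      walsh {e} H < -(τ * n ^ 2)} : ℝ) ≤
      2 ^ Fintype.card (Pair n) * (1 / (2 * τ ^ 2 * n)) ^ n := by
  classical
  have hn0 : (0 : ℝ) < n := by exact_mod_cast Nat.pos_of_ne_zero hn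
  set c : Pair n → ℝ := Set.indicator {e | e.1 ∈ (cutGraph A).edgeSet} 1 with hc
  have h := sum_walsh_comp_pow_le (S := fun e : Pair n => ({e} : Finset (Pair n))) hn
    (singleton_injective) (d := 1) (fun _ => (card_singleton _).le) c
  have hcs : ∑ e, c e ^ 2 ≤ (n : ℝ) ^ 2 / 4 := by
    refine le_trans (le_of_eq ?_) (mul_sub_le_sq_div_four A)
    rw [← Nat.cast_mul, ← card_edgeSet_cutGraph A, card_filter]
    push_cast
    refine sum_congr rfl fun e _ => ?_
    by_cases h2 : e.1 ∈ (cutGraph A).edgeSet <;> simp [hc, h2]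
  have hle : (#{H : Finset (Pair n) | ∑ e : Pair n, c e * walsh {e} H < -(τ * n ^ 2)} : ℝ) *
      (τ * n ^ 2) ^ (2 * n) ≤ ∑ H : Finset (Pair n), (∑ e, c e * walsh {e} H) ^ (2 * n) := by
    rw [← nsmul_eq_mul, ← sum_const]
    refine (sum_le_sum fun H hH => ?_).trans
      (sum_le_univ_sum_of_nonneg fun H => (even_two_mul n).pow_nonneg _)
    rw [mem_filter] at hH
    rw [← (even_two_mul n).neg_pow (∑ e, c e * walsh {e} H)]
    gcongr
    linarith [hH.2]
  have h3 := hle.trans h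
  rw [← le_div_iff₀ (by positivity)] at h3
  refine h3.trans ?_
  rw [div_le_iff₀ (by positivity), mul_assoc]
  gcongr
  rw [pow_mul, ← mul_pow]
  refine pow_le_pow_left₀ (by positivity) ?_ n
  calc (2 * (n : ℝ)) ^ 1 * ∑ e, c e ^ 2 ≤ (2 * (n : ℝ)) ^ 1 * ((n : ℝ) ^ 2 / 4) := by gcongr
    _ = 1 / (2 * τ ^ 2 * n) * (τ * n ^ 2) ^ 2 := by field_simp; ring

lemma two_pow_le_mul_choose_half (N : ℕ) : 2 ^ N ≤ (N + 1) * N.choose (N / 2) := by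
  calc 2 ^ N = ∑ r ∈ range (N + 1), N.choose r := (Nat.sum_range_choose N).symm
    _ ≤ ∑ r ∈ range (N + 1), N.choose (N / 2) := sum_le_sum fun r _ => Nat.choose_le_middle r N
    _ = _ := by simp

/-- The sets that contain half of the pairs, rounded up, and whose graph has no cut much larger
than half of the largest possible cut. -/
noncomputable def smallCutFamily (n : ℕ) (τ : ℝ) : Finset (Finset (Pair n)) :=
  open Classical in
  {H | #H = Fintype.card (Pair n) - Fintype.card (Pair n) / 2 ∧
    (maxCut (pairGraph H) : ℝ) ≤ n ^ 2 / 8 + τ * n ^ 2 / 2}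

/-- A random set of half of the pairs has a maximum cut close to half of its size, with a
probability bounded below by an inverse polynomial even without conditioning on its size. -/
lemma two_pow_le_card_smallCutFamily {τ : ℝ} (hτ : 0 < τ) (hn : 2 ≤ n) (hτn : 4 ≤ τ ^ 2 * n) :
    (2 : ℝ) ^ Fintype.card (Pair n) ≤ #(smallCutFamily n τ) * n ^ 2 := by
  classical
  set N := Fintype.card (Pair n) with hN
  have hn0 : (0 : ℝ) < n := by positivity
  let bad : Finset (Fin n) → Finset (Finset (Pair n)) := fun A =>
    {H | ∑ e : Pair n, Set.indicator {e | e.1 ∈ (cutGraph A).edgeSet} 1 e *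
      walsh {e} H < -(τ * n ^ 2)}
  -- the sets of the right size number at least `2 ^ N / (N + 1)`; half as many may be bad for a cut
  have hsub : powersetCard (N - N / 2) (univ : Finset (Pair n)) ⊆
      smallCutFamily n τ ∪ univ.biUnion bad := by
    intro H hH
    rw [mem_powersetCard_univ] at hH
    by_cases hb : ∃ A, H ∈ bad A
    · exact mem_union_right _ (by simpa using hb)
    push Not at hb
    refine mem_union_left _ (mem_filter.2 ⟨mem_univ _, hH, ?_⟩)
    have hcut : maxCut (pairGraph H) ≤ ⌊(n : ℝ) ^ 2 / 8 + τ * n ^ 2 / 2⌋₊ := by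
      rw [maxCut_eq_sup]
      refine Finset.sup_le fun A _ => Nat.le_floor ?_
      have h1 := card_pairGraph_inter_cut H A
      have h2 := mul_sub_le_sq_div_four A
      have h3 := hb A
      simp only [bad, mem_filter, mem_univ, true_and, not_lt] at h3
      linarith
    exact (Nat.cast_le.2 hcut).trans (Nat.floor_le (by positivity))
  have hcard : (N.choose (N / 2) : ℝ) ≤ #(smallCutFamily n τ) +
      ∑ A : Finset (Fin n), (#(bad A) : ℝ) := by
    have h1 := (card_le_card hsub).trans ((card_union_le _ _).trans
      (Nat.add_le_add_left card_biUnion_le _))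
    rw [card_powersetCard, card_univ, ← hN, Nat.choose_symm (Nat.div_le_self _ _)] at h1
    exact_mod_cast h1
  have hbad : ∑ A : Finset (Fin n), (#(bad A) : ℝ) ≤ 2 ^ N * (1 / 4) ^ n := by
    -- the union bound over all cuts
    calc ∑ A : Finset (Fin n), (#(bad A) : ℝ)
        ≤ ∑ A : Finset (Fin n), 2 ^ N * (1 / (2 * τ ^ 2 * n)) ^ n :=
          sum_le_sum fun A _ => card_filter_large_cut_le hτ (by omega) A
      _ = 2 ^ N * (2 * (1 / (2 * τ ^ 2 * n))) ^ n := by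
          rw [sum_const, card_univ, Fintype.card_finset, Fintype.card_fin, nsmul_eq_mul, mul_pow]
          push_cast; ring
      _ ≤ 2 ^ N * (1 / 4) ^ n := by
          gcongr
          rw [show 2 * (1 / (2 * τ ^ 2 * n)) = 1 / (τ ^ 2 * n) by field_simp]
          gcongr
  have hmid : (2 : ℝ) ^ N ≤ (N + 1) * N.choose (N / 2) := by
    exact_mod_cast two_pow_le_mul_choose_half N
  have h4 : 2 * ((N : ℝ) + 1) ≤ 4 ^ n := by
    have h5 : (n : ℝ) ^ 2 ≤ 4 ^ n := by
      rw [show (4 : ℝ) = 2 ^ 2 by norm_num, ← pow_mul, mul_comm, pow_mul]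
      gcongr
      exact_mod_cast Nat.lt_two_pow_self.le
    have := two_mul_card_pair n
    have hn2 : (2 : ℝ) ≤ n := by exact_mod_cast hn
    rw [← hN] at this
    nlinarith
  have hN2 : 2 * ((N : ℝ) + 1) ≤ n ^ 2 := by
    have := two_mul_card_pair n
    have hn2 : (2 : ℝ) ≤ n := by exact_mod_cast hn
    rw [← hN] at this
    nlinarith
  have h6 : 2 * ((N : ℝ) + 1) * (2 ^ N * (1 / 4) ^ n) ≤ 2 ^ N := by
    have : 2 * ((N : ℝ) + 1) * (1 / 4) ^ n ≤ 1 := by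
      rw [one_div, inv_pow, ← div_eq_mul_inv, div_le_one (by positivity)]
      exact h4
    calc _ = 2 ^ N * (2 * ((N : ℝ) + 1) * (1 / 4) ^ n) := by ring
      _ ≤ 2 ^ N * 1 := by gcongr
      _ = _ := mul_one _
  calc (2 : ℝ) ^ N ≤ #(smallCutFamily n τ) * (2 * ((N : ℝ) + 1)) := by
        have h7 : 2 * (((N : ℝ) + 1) * N.choose (N / 2)) ≤ 2 * (((N : ℝ) + 1) *
            (#(smallCutFamily n τ) + 2 ^ N * (1 / 4) ^ n)) := by
          gcongr
          linarith
        nlinarith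
    _ ≤ _ := by gcongr

end Graphs

/-! ### The space lower bound -/

lemma edgeSample_apply {V : Type*} [Fintype V] (G : SimpleGraph V) (hG : G.edgeSet.Nonempty)
    [Fintype G.edgeSet] (e : Sym2 V) [Decidable (e ∈ G.edgeSet)] :
    edgeSample G hG e = if e ∈ G.edgeSet then (#G.edgeFinset : ENNReal)⁻¹ else 0 := by
  unfold edgeSample
  rw [PMF.uniformOfFinset_apply]
  simp only [SimpleGraph.mem_edgeFinset]
  congr!

section Law

variable {n s : ℕ}

open Classical in
/-- The probability of an output event for a fixed seed, as a finite recursion over the letters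
of the stream. -/
lemma toMeasure_map_iid (A : StreamingAlgorithm n s) (r : A.Seed) (G : SimpleGraph (Fin n))
    (hG : G.edgeSet.Nonempty) {M : ℕ} (hM : #{e : Pair n | e.1 ∈ G.edgeSet} = M)
    {z : Pair n → ℝ} (hz : ∀ e, z e = if e.1 ∈ G.edgeSet then 1 else -1)
    {F : Set ℝ} (hF : MeasurableSet F) (T t : ℕ) (q : Fin s → Bool) :
    ((iid (edgeSample G hG) T).map fun σ => A.output r (A.runFrom r t q σ)).toMeasure F =
      ENNReal.ofReal (streamExpect (fun e => (1 + z e) / (2 * M))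
        (fun t q (e : Pair n) => A.update r t q e.1) ((A.output r ⁻¹' F).indicator 1) T t q) := by
  have hM0 : 0 < M := by
    obtain ⟨e, he⟩ := hG
    rw [← hM]
    exact card_pos.2 ⟨⟨e, G.not_isDiag_of_mem_edgeSet he⟩, by simpa using he⟩
  have hp0 : ∀ e, 0 ≤ (1 + z e) / (2 * M) := fun e => by
    rw [hz]; split_ifs <;> positivity
  have hp : ∀ e : Pair n, edgeSample G hG e.1 = ENNReal.ofReal ((1 + z e) / (2 * M)) := by
    intro e
    rw [edgeSample_apply, card_edgeFinset_eq, hM, hz]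
    split_ifs
    · rw [show (1 + 1 : ℝ) / (2 * M) = (M : ℝ)⁻¹ by field_simp; norm_num,
        ENNReal.ofReal_inv_of_pos (by positivity), ENNReal.ofReal_natCast]
    · simp
  induction T generalizing t q with
  | zero =>
    rw [iid, PMF.pure_map, PMF.toMeasure_pure_apply _ _ hF, streamExpect]
    by_cases h : A.output r q ∈ F <;> simp [StreamingAlgorithm.runFrom, h]
  | succ T ih =>
    rw [iid, PMF.map_bind, PMF.toMeasure_bind_apply _ _ _ hF, tsum_fintype, streamExpect,
      ENNReal.ofReal_sum_of_nonneg]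
    · symm
      refine Fintype.sum_of_injective Subtype.val Subtype.val_injective _ _ (fun e he => ?_)
        fun e => ?_
      · have : e ∉ G.edgeSet := fun h => he ⟨⟨e, G.not_isDiag_of_mem_edgeSet h⟩, rfl⟩
        rw [edgeSample_apply, if_neg this, zero_mul]
      · rw [hp, ENNReal.ofReal_mul (hp0 e), ← ih, PMF.map_comp]
        rfl
    · exact fun e _ => mul_nonneg (hp0 e) (streamExpect_nonneg hp0
        (fun q => Set.indicator_nonneg (fun _ _ => zero_le_one) q) _ _ _)

lemma toMeasure_outputLaw (A : StreamingAlgorithm n s) (p : PMF (List (Sym2 (Fin n))))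
    {F : Set ℝ} (hF : MeasurableSet F) :
    (A.outputLaw p).toMeasure F = ∑' r, A.coins r * (p.map (A.eval r)).toMeasure F :=
  PMF.toMeasure_bind_apply _ _ _ hF

/-- A bound on the mean over a family of parameters, for a randomized algorithm that is good for
each of them. -/
lemma le_tsum_mul_mean {R θ : Type*} (c : PMF R) {Θ : Finset θ} (hΘ : Θ.Nonempty)
    (f : R → θ → ENNReal) {p : ENNReal} (h : ∀ x ∈ Θ, p ≤ ∑' r, c r * f r x) :
    p ≤ ∑' r, c r * ((#Θ : ENNReal)⁻¹ * ∑ x ∈ Θ, f r x) := by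
  have h0 : (#Θ : ENNReal) ≠ 0 := by simpa using hΘ.ne_empty
  calc p = (#Θ : ENNReal)⁻¹ * ∑ x ∈ Θ, p := by
        rw [sum_const, nsmul_eq_mul, ← mul_assoc, ENNReal.inv_mul_cancel h0 (by simp), one_mul]
    _ ≤ (#Θ : ENNReal)⁻¹ * ∑ x ∈ Θ, ∑' r, c r * f r x := by gcongr with x hx; exact h x hx
    _ = ∑' r, (#Θ : ENNReal)⁻¹ * ∑ x ∈ Θ, c r * f r x := by
        rw [ENNReal.tsum_mul_left, Summable.tsum_finsetSum fun _ _ => ENNReal.summable]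
    _ = _ := tsum_congr fun r => by rw [← mul_sum, mul_left_comm]

lemma inv_card_mul_sum_ofReal_le {θ : Type*} {Θ : Finset θ} {P : θ → ℝ} {B : ℝ}
    (hΘ : Θ.Nonempty) (hP : ∀ x ∈ Θ, 0 ≤ P x) (h : ∑ x ∈ Θ, P x ≤ #Θ * B) :
    (#Θ : ENNReal)⁻¹ * ∑ x ∈ Θ, ENNReal.ofReal (P x) ≤ ENNReal.ofReal B ∧ 0 ≤ B := by
  have h0 : 0 < (#Θ : ℝ) := by exact_mod_cast hΘ.card_pos
  have h00 : (#Θ : ENNReal) ≠ 0 := by simpa using hΘ.ne_empty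
  constructor
  · rw [← ENNReal.ofReal_sum_of_nonneg hP]
    refine (mul_le_mul_right (ENNReal.ofReal_le_ofReal h) _).trans_eq ?_
    rw [ENNReal.ofReal_mul h0.le, ENNReal.ofReal_natCast, ← mul_assoc,
      ENNReal.inv_mul_cancel h00 (by simp), one_mul]
  · exact nonneg_of_mul_nonneg_right ((sum_nonneg hP).trans h) h0

/-- A family of graphs whose edges are given by distinct characters of degree at most two, and
which is not too sparse in its cube, is hidden from a memory of `s` bits. -/
lemma sum_streamExpect_le_of_dense {ι : Type*} [Fintype ι] [DecidableEq ι] (hn : 2 ≤ n)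
    {S : Pair n → Finset ι} (hS : Function.Injective S) (hS2 : ∀ e, #(S e) ≤ 2)
    {Θ : Finset (Finset ι)} (hΘ : (2 : ℝ) ^ Fintype.card ι ≤ #Θ * n ^ 2)
    {M : ℕ} (hM : Fintype.card (Pair n) ≤ 2 * M) (hΘM : ∀ x ∈ Θ, #{e | walsh (S e) x = -1} = M)
    {k : ℕ} (hk : k ≠ 0) (hks : 2 ^ s * n ^ 2 ≤ 2 ^ k)
    (upd : ℕ → (Fin s → Bool) → Pair n → (Fin s → Bool)) (F : Set (Fin s → Bool)) (T : ℕ)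
    (q₀ : Fin s → Bool) :
    ∑ x ∈ Θ, streamExpect (fun e => (1 + -walsh (S e) x) / (2 * M)) upd (F.indicator 1) T 0 q₀ ≤
      #Θ * (32 * T * k ^ 2 / Fintype.card (Pair n) + 13 / 10 *
        streamExpect (fun _ => (Fintype.card (Pair n) : ℝ)⁻¹) upd (F.indicator 1) T 0 q₀) := by
  set N := Fintype.card (Pair n) with hN
  have hN0 : 0 < N := by rw [hN, card_pair]; exact Nat.choose_pos hn
  have : Nonempty (Pair n) := Fintype.card_pos_iff.1 hN0
  have hM0 : (0 : ℝ) < M := by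
    have : 0 < M := by omega
    exact_mod_cast this
  have hk0 : (0 : ℝ) < k := by exact_mod_cast Nat.pos_of_ne_zero hk
  have h := sum_streamExpect_indicator_le (α := Pair n) (Θ := Θ) (z := fun x e => -walsh (S e) x)
    (κ := (2 * k) ^ 2) (D := #Θ * n ^ 2) (M := M) hk (by positivity) (by positivity) ?_
    (by exact_mod_cast hM) ?_ ?_ upd F T q₀
  · refine h.trans ?_
    have hQ : (Fintype.card (Fin s → Bool) : ℝ) * (#Θ * n ^ 2 / 2 ^ k) ≤ #Θ := by
      have h2 : (2 : ℝ) ^ s * n ^ 2 ≤ 2 ^ k := by exact_mod_cast hks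
      rw [Fintype.card_fun, Fintype.card_bool, Fintype.card_fin]
      push_cast
      rw [mul_div_assoc', div_le_iff₀ (by positivity)]
      calc (2 : ℝ) ^ s * (#Θ * n ^ 2) = #Θ * (2 ^ s * n ^ 2) := by ring
        _ ≤ _ := by gcongr
    rw [mul_add (#Θ : ℝ)]
    refine add_le_add ?_ le_rfl
    calc 2 * (T : ℝ) * (2 * (2 * k) ^ 2 / Fintype.card (Pair n) *
          (#Θ + Fintype.card (Fin s → Bool) * (#Θ * n ^ 2 / 2 ^ k)))
        ≤ 2 * (T : ℝ) * (2 * (2 * k) ^ 2 / Fintype.card (Pair n) * (#Θ + #Θ)) := by gcongr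
      _ = _ := by rw [← hN]; ring
  · intro c
    have h1 := sum_walsh_comp_pow_le hk hS hS2 fun e => -c e
    simp only [neg_sq] at h1
    calc ∑ x ∈ Θ, (∑ e, c e * -walsh (S e) x) ^ (2 * k)
        ≤ ∑ x, (∑ e, -c e * walsh (S e) x) ^ (2 * k) := by
          simp only [mul_neg, neg_mul]
          exact sum_le_univ_sum_of_nonneg fun x => (even_two_mul k).pow_nonneg _
      _ ≤ _ := h1
      _ ≤ _ := by gcongr
  · intro x _ e
    rcases walsh_eq_or (S e) x with h1 | h1 <;> simp only [h1] <;> norm_num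
  · intro x hx
    have h1 : ∀ e, (1 + -walsh (S e) x) / (2 * M) = if walsh (S e) x = -1 then (M : ℝ)⁻¹ else 0 := by
      intro e
      rcases walsh_eq_or (S e) x with h1 | h1 <;> rw [h1] <;> norm_num
      field_simp
    simp only [h1]
    rw [← sum_filter, sum_const, hΘM x hx, nsmul_eq_mul, mul_inv_cancel₀ hM0.ne']

/-- The space lower bound in finite form: the best `k` is about `s + 2 * log₂ n`. The hypothesis
`hgap` separates the approximate maximum cuts of the two hard families. -/
theorem le_mul_sq_of_approximatesMaxCut (hn : 2 ≤ n) {τ γ : ℝ} (hτ : 0 < τ) (hτn : 4 ≤ τ ^ 2 * n)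
    (hγ : 0 < γ) (hgap : ((n : ℝ) ^ 2 / 8 + τ * n ^ 2 / 2) * γ < (n / 2 * (n - n / 2) : ℕ))
    {k : ℕ} (hk : k ≠ 0) (hks : 2 ^ s * n ^ 2 ≤ 2 ^ k) {T : ℕ} (A : StreamingAlgorithm n s)
    (hA : A.ApproximatesMaxCut T γ (99 / 100)) :
    (68 / 100 : ℝ) ≤ 64 * T * k ^ 2 / Fintype.card (Pair n) := by
  classical
  set N := Fintype.card (Pair n) with hN
  have hN0 : 0 < N := by rw [hN, card_pair]; exact Nat.choose_pos hn
  have hn0 : (0 : ℝ) < n := by positivity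
  have htwoN : 2 * (N : ℝ) = n * (n - 1) := two_mul_card_pair n
  -- the two families of graphs, and their numbers of edges
  set ΘY : Finset (Finset (Fin n)) := powersetCard (n / 2) univ with hΘY
  set ΘN := smallCutFamily n τ with hΘN
  set MY := n / 2 * (n - n / 2) with hMY
  set MN := N - N / 2 with hMN
  have hMYN : N ≤ 2 * MY := by
    have h1 : 2 * N = n * (n - 1) := by
      zify [show 1 ≤ n by omega]; exact_mod_cast htwoN
    have h2 : n * (n - 1) ≤ 2 * (2 * MY) := by
      rcases Nat.even_or_odd' n with ⟨m, hm | hm⟩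
      · have h3 : n / 2 = m := by omega
        rw [hMY, h3, show n - m = m by omega, hm]
        have : 2 * m - 1 ≤ 2 * m := Nat.sub_le _ _
        nlinarith
      · have h3 : n / 2 = m := by omega
        rw [hMY, h3, show n - m = m + 1 by omega, hm, Nat.add_sub_cancel]
        nlinarith
    omega
  have hΘYcard : (2 : ℝ) ^ Fintype.card (Fin n) ≤ #ΘY * n ^ 2 := by
    have h1 : (2 : ℝ) ^ n ≤ (n + 1) * n.choose (n / 2) := by
      exact_mod_cast two_pow_le_mul_choose_half n
    rw [hΘY, card_powersetCard, card_univ, Fintype.card_fin, mul_comm]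
    refine h1.trans ?_
    have hn2 : (2 : ℝ) ≤ n := by exact_mod_cast hn
    gcongr
    nlinarith
  have hΘNcard : (2 : ℝ) ^ Fintype.card (Pair n) ≤ #ΘN * n ^ 2 :=
    two_pow_le_card_smallCutFamily hτ hn hτn
  have nonempty : ∀ {m : ℕ} {θ : Type} {Θ : Finset θ}, (2 : ℝ) ^ m ≤ #Θ * n ^ 2 → Θ.Nonempty := by
    intro m θ Θ h
    by_contra h'
    rw [not_nonempty_iff_eq_empty] at h'
    rw [h', card_empty, Nat.cast_zero, zero_mul] at h
    exact absurd h (not_le.2 (by positivity))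
  have hYM : ∀ x ∈ ΘY, #{e : Pair n | e.1 ∈ (cutGraph x).edgeSet} = MY := by
    intro x hx
    rw [card_edgeSet_cutGraph, (mem_powersetCard_univ.1 hx), hMY]
  have hNM : ∀ x ∈ ΘN, #{e : Pair n | e.1 ∈ (pairGraph x).edgeSet} = MN := by
    intro x hx
    rw [card_edgeSet_pairGraph, (mem_filter.1 hx).2.1]
  have edges : ∀ {G : SimpleGraph (Fin n)} {M : ℕ}, N ≤ 2 * M →
      #{e : Pair n | e.1 ∈ G.edgeSet} = M → G.edgeSet.Nonempty := by
    intro G M hM h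
    obtain ⟨e, he⟩ := card_pos.1 (show 0 < #{e : Pair n | e.1 ∈ G.edgeSet} by omega)
    exact ⟨e.1, (mem_filter.1 he).2⟩
  have hMNN : N ≤ 2 * MN := by omega
  -- the event that separates the outputs on the two families
  set F : Set ℝ := Set.Ici (MY / γ) with hF
  have hFm : MeasurableSet F := measurableSet_Ici
  set zY : Finset (Fin n) → Pair n → ℝ := fun x e => -walsh e.1.toFinset x with hzY
  set zN : Finset (Pair n) → Pair n → ℝ := fun x e => -walsh {e} x with hzN
  set PY : A.Seed → Finset (Fin n) → ℝ := fun r x =>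
    streamExpect (fun e => (1 + zY x e) / (2 * MY)) (fun t q (e : Pair n) => A.update r t q e.1)
      ((A.output r ⁻¹' F).indicator 1) T 0 (A.init r) with hPY
  set PN : A.Seed → Finset (Pair n) → ℝ := fun r x =>
    streamExpect (fun e => (1 + zN x e) / (2 * MN)) (fun t q (e : Pair n) => A.update r t q e.1)
      ((A.output r ⁻¹' Fᶜ).indicator 1) T 0 (A.init r) with hPN
  have hY : ∀ x ∈ ΘY, (99 / 100 : ENNReal) ≤ ∑' r, A.coins r * ENNReal.ofReal (PY r x) := by
    intro x hx
    have hG := edges hMYN (hYM x hx)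
    refine (hA (cutGraph x) hG).trans ?_
    have hsub : Set.Icc ((maxCut (cutGraph x) : ℝ) / γ) (maxCut (cutGraph x)) ⊆ F := by
      intro y hy
      refine le_trans ?_ hy.1
      have := le_maxCut_cutGraph x
      rw [mem_powersetCard_univ.1 hx, ← hMY] at this
      gcongr
    refine (MeasureTheory.measure_mono hsub).trans_eq ?_
    rw [toMeasure_outputLaw A _ hFm]
    refine tsum_congr fun r => ?_
    rw [hPY, ← toMeasure_map_iid A r (cutGraph x) hG (hYM x hx) _ hFm]
    · rfl
    · intro e
      rw [hzY]
      rcases walsh_eq_or e.1.toFinset x with h1 | h1 <;>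
        simp only [mem_edgeSet_cutGraph, h1] <;> norm_num
  have hNo : ∀ x ∈ ΘN, (99 / 100 : ENNReal) ≤ ∑' r, A.coins r * ENNReal.ofReal (PN r x) := by
    intro x hx
    have hG := edges hMNN (hNM x hx)
    refine (hA (pairGraph x) hG).trans ?_
    have hsub : Set.Icc ((maxCut (pairGraph x) : ℝ) / γ) (maxCut (pairGraph x)) ⊆ Fᶜ := by
      intro y hy hyF
      have h1 := (mem_filter.1 hx).2.2
      have h2 : (MY : ℝ) / γ ≤ y := hyF
      rw [div_le_iff₀ hγ] at h2
      have h3 : y * γ ≤ ((n : ℝ) ^ 2 / 8 + τ * n ^ 2 / 2) * γ := by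
        gcongr
        exact hy.2.trans h1
      linarith
    refine (MeasureTheory.measure_mono hsub).trans_eq ?_
    rw [toMeasure_outputLaw A _ hFm.compl]
    refine tsum_congr fun r => ?_
    rw [hPN, ← toMeasure_map_iid A r (pairGraph x) hG (hNM x hx) _ hFm.compl]
    · rfl
    · intro e
      rw [hzN]
      rcases walsh_eq_or {e} x with h1 | h1 <;>
        simp only [mem_edgeSet_pairGraph, h1] <;> norm_num
  -- for each seed both families look like the uniform stream
  have seed : ∀ r, (#ΘY : ENNReal)⁻¹ * ∑ x ∈ ΘY, ENNReal.ofReal (PY r x) +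
      (#ΘN : ENNReal)⁻¹ * ∑ x ∈ ΘN, ENNReal.ofReal (PN r x) ≤
      ENNReal.ofReal (64 * T * k ^ 2 / N + 13 / 10) := by
    intro r
    have h1 := sum_streamExpect_le_of_dense hn toFinset_pair_injective
      (fun e => (Sym2.card_toFinset_of_not_isDiag e.1 e.2).le) hΘYcard hMYN
      (fun x hx => by simpa only [mem_edgeSet_cutGraph] using hYM x hx) hk hks
      (fun t q (e : Pair n) => A.update r t q e.1) (A.output r ⁻¹' F) T (A.init r)
    have h2 := sum_streamExpect_le_of_dense hn (S := fun e : Pair n => ({e} : Finset (Pair n)))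
      singleton_injective (fun e => by simp) hΘNcard hMNN
      (fun x hx => by simpa only [mem_edgeSet_pairGraph] using hNM x hx) hk hks
      (fun t q (e : Pair n) => A.update r t q e.1) (A.output r ⁻¹' Fᶜ) T (A.init r)
    set u : Pair n → ℝ := fun _ => (Fintype.card (Pair n) : ℝ)⁻¹ with hu
    have hu1 : ∑ e, u e = 1 := by
      rw [hu, sum_const, card_univ, nsmul_eq_mul, mul_inv_cancel₀]
      exact_mod_cast hN0.ne'
    have h3 : streamExpect u (fun t q (e : Pair n) => A.update r t q e.1)
        ((A.output r ⁻¹' Fᶜ).indicator 1) T 0 (A.init r) =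
        1 + -1 * streamExpect u (fun t q (e : Pair n) => A.update r t q e.1)
        ((A.output r ⁻¹' F).indicator 1) T 0 (A.init r) := by
      rw [← streamExpect_const_add_mul hu1]
      congr 1
      ext q
      by_cases hq : A.output r q ∈ F <;> simp [hq]
    have ind0 : ∀ F' : Set (Fin s → Bool), ∀ q, 0 ≤ F'.indicator (1 : (Fin s → Bool) → ℝ) q :=
      fun F' q => Set.indicator_nonneg (fun _ _ => zero_le_one) q
    obtain ⟨h4, h4'⟩ := inv_card_mul_sum_ofReal_le (nonempty hΘYcard)
      (fun x _ => streamExpect_nonneg (fun e => by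
        rcases walsh_eq_or e.1.toFinset x with h1 | h1 <;> rw [h1] <;> norm_num
        positivity) (ind0 _) _ _ _) h1
    obtain ⟨h5, h5'⟩ := inv_card_mul_sum_ofReal_le (nonempty hΘNcard)
      (fun x _ => streamExpect_nonneg (fun e => by
        rcases walsh_eq_or {e} x with h1 | h1 <;> rw [h1] <;> norm_num
        positivity) (ind0 _) _ _ _) h2
    refine (add_le_add h4 h5).trans_eq ?_
    rw [← ENNReal.ofReal_add h4' h5', h3]
    congr 1
    rw [← hN]
    ring
  have hfin : (99 / 100 + 99 / 100 : ENNReal) ≤ ENNReal.ofReal (64 * T * k ^ 2 / N + 13 / 10) := by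
    calc (99 / 100 + 99 / 100 : ENNReal)
        ≤ ∑' r, A.coins r * ((#ΘY : ENNReal)⁻¹ * ∑ x ∈ ΘY, ENNReal.ofReal (PY r x)) +
          ∑' r, A.coins r * ((#ΘN : ENNReal)⁻¹ * ∑ x ∈ ΘN, ENNReal.ofReal (PN r x)) :=
          add_le_add (le_tsum_mul_mean A.coins (nonempty hΘYcard) _ hY)
            (le_tsum_mul_mean A.coins (nonempty hΘNcard) _ hNo)
      _ = ∑' r, A.coins r * ((#ΘY : ENNReal)⁻¹ * ∑ x ∈ ΘY, ENNReal.ofReal (PY r x) +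
          (#ΘN : ENNReal)⁻¹ * ∑ x ∈ ΘN, ENNReal.ofReal (PN r x)) := by
          rw [← ENNReal.tsum_add]
          exact tsum_congr fun r => (mul_add _ _ _).symm
      _ ≤ ∑' r, A.coins r * ENNReal.ofReal (64 * T * k ^ 2 / N + 13 / 10) := by
          gcongr with r
          exact seed r
      _ = _ := by rw [ENNReal.tsum_mul_right, A.coins.tsum_coe, one_mul]
  have h99 : (99 / 100 + 99 / 100 : ENNReal) = ENNReal.ofReal (198 / 100) := by
    rw [show (198 / 100 : ℝ) = 99 / 100 + 99 / 100 by norm_num,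
      ENNReal.ofReal_add (by norm_num) (by norm_num), ENNReal.ofReal_div_of_pos (by norm_num)]
    simp
  rw [h99, ENNReal.ofReal_le_ofReal_iff (by positivity)] at hfin
  linarith

end Law
end MaxCutStream

open Filter in
theorem theorem2 (ε : ℝ) (hε : 0 < ε) (hε2 : ε < 2) (C : ℝ) (hC : 0 < C) :
    ∃ (c : ℝ) (K n₀ : ℕ), 0 < c ∧
      ∀ n : ℕ, n₀ ≤ n →
      ∀ ℓ : ℕ, 0 < ℓ → (ℓ : ℝ) < (Real.log n) ^ C →
      ∀ (s : ℕ) (A : MaxCutStream.StreamingAlgorithm n s),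
        A.ApproximatesMaxCut (ℓ * n) (2 - ε) (99 / 100) →
        c * √(n : ℝ) / (Real.log n) ^ K ≤ (s : ℝ) := by
  set K := ⌈C⌉₊ with hK
  have hlarge : ∀ᶠ n : ℕ in atTop, 3 ≤ n ∧ 4 ≤ (ε / 16) ^ 2 * n ∧
      Real.log n ^ (K + 2) ≤ 1 / 25600 * n := by
    refine (eventually_ge_atTop 3).and (Eventually.and ?_ ?_)
    · have := tendsto_natCast_atTop_atTop (R := ℝ).const_mul_atTop
        (show 0 < (ε / 16) ^ 2 by positivity)
      exact this.eventually_ge_atTop 4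
    · have h1 := (Real.isLittleO_pow_log_id_atTop (n := K + 2)).bound
        (show (0 : ℝ) < 1 / 25600 by norm_num)
      filter_upwards [tendsto_natCast_atTop_atTop.eventually h1] with n hn
      simpa using (le_abs_self _).trans hn
  obtain ⟨n₀, hn₀⟩ := eventually_atTop.1 hlarge
  refine ⟨1 / 100, K, n₀, by norm_num, fun n hn ℓ hℓ hℓC s A hA => ?_⟩
  obtain ⟨hn3, hεn, hlogn⟩ := hn₀ n hn
  have hn0 : (0 : ℝ) < n := by positivity
  have hn3' : (3 : ℝ) ≤ n := by exact_mod_cast hn3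
  have hlog1 : 1 ≤ Real.log n := by
    rw [Real.le_log_iff_exp_le hn0]
    exact (Real.exp_one_lt_d9.le.trans (by norm_num)).trans hn3'
  have hℓK : (ℓ : ℝ) ≤ Real.log n ^ K := by
    rw [← Real.rpow_natCast]
    exact hℓC.le.trans (Real.rpow_le_rpow_of_exponent_le hlog1 (Nat.le_ceil C))
  set k := s + 2 * (Nat.log 2 n + 1) with hk
  have hks : 2 ^ s * n ^ 2 ≤ 2 ^ k := by
    rw [hk, pow_add, mul_comm 2, pow_mul]
    gcongr
    exact (Nat.lt_pow_succ_log_self (by norm_num) n).le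
  -- `τ = ε / 16` is small enough for the gap between the two values of the maximum cut
  have hgap : ((n : ℝ) ^ 2 / 8 + ε / 16 * n ^ 2 / 2) * (2 - ε) < (n / 2 * (n - n / 2) : ℕ) := by
    have h1 : (n : ℝ) ^ 2 / 4 - 1 / 4 ≤ (n / 2 * (n - n / 2) : ℕ) := by
      rcases Nat.even_or_odd' n with ⟨m, hm | hm⟩
      · rw [show n / 2 = m by omega, show n - m = m by omega, hm]
        push_cast; nlinarith
      · rw [show n / 2 = m by omega, show n - m = m + 1 by omega, hm]
        push_cast; nlinarith
    have h2 : 4 < ε * n ^ 2 := by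
      have : 512 ≤ ε * n := by nlinarith
      nlinarith
    nlinarith
  have hmain := MaxCutStream.le_mul_sq_of_approximatesMaxCut (by omega) (τ := ε / 16)
    (by positivity) hεn (by linarith) hgap (k := k) (by omega) hks A hA
  have hN : (n : ℝ) ^ 2 / 4 ≤ Fintype.card (MaxCutStream.Pair n) := by
    have := MaxCutStream.two_mul_card_pair n
    nlinarith
  have hkle : (k : ℝ) ≤ s + 5 * Real.log n := by
    have h1 : (Nat.log 2 n : ℝ) ≤ 3 / 2 * Real.log n := by
      have h2 : (Nat.log 2 n : ℝ) * Real.log 2 ≤ Real.log n := by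
        rw [← Real.log_pow]
        refine Real.log_le_log (by positivity) ?_
        exact_mod_cast Nat.pow_log_le_self 2 (by omega)
      have h3 := Real.log_two_gt_d9
      nlinarith [Nat.cast_nonneg (α := ℝ) (Nat.log 2 n)]
    rw [hk]
    push_cast
    linarith
  by_contra! hs
  have hLK : 1 ≤ Real.log n ^ K := one_le_pow₀ hlog1
  have hs2 : (s : ℝ) ^ 2 * Real.log n ^ K ≤ 1 / 10000 * n := by
    have h1 : (s : ℝ) * Real.log n ^ K ≤ 1 / 100 * √n := by
      rw [← le_div_iff₀ (by positivity)]; exact hs.le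
    have h2 : ((s : ℝ) * Real.log n ^ K) ^ 2 ≤ (1 / 100 * √n) ^ 2 := by gcongr
    rw [mul_pow (1 / 100 : ℝ), Real.sq_sqrt hn0.le] at h2
    calc (s : ℝ) ^ 2 * Real.log n ^ K ≤ (s : ℝ) ^ 2 * (Real.log n ^ K * Real.log n ^ K) := by
          gcongr
          exact le_mul_of_one_le_left (by positivity) hLK
      _ = ((s : ℝ) * Real.log n ^ K) ^ 2 := by ring
      _ ≤ _ := h2.trans (by linarith)
  have hk2 : (k : ℝ) ^ 2 ≤ 2 * s ^ 2 + 50 * Real.log n ^ 2 := by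
    calc (k : ℝ) ^ 2 ≤ (s + 5 * Real.log n) ^ 2 := by gcongr
      _ ≤ _ := by nlinarith [sq_nonneg ((s : ℝ) - 5 * Real.log n)]
  have hlk : (ℓ : ℝ) * k ^ 2 ≤ 1 / 400 * n := by
    calc (ℓ : ℝ) * k ^ 2 ≤ Real.log n ^ K * (2 * s ^ 2 + 50 * Real.log n ^ 2) := by gcongr
      _ = 2 * ((s : ℝ) ^ 2 * Real.log n ^ K) + 50 * Real.log n ^ (K + 2) := by ring
      _ ≤ _ := by linarith
  rw [le_div_iff₀ (hN.trans_lt' (by positivity))] at hmain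
  push_cast at hmain
  nlinarith
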